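/- Let $p$ be a prime and let $\mathcal O$ be a complete discrete valuation ring whose residue field has characteristic $p$ and whose quotient field has characteristic zero (neither field is assumed to be a splitting field for $G$). Let $G$ be a finite group, and let $I(\mathcal OG)$ denote the augmentation ideal of the group algebra $\mathcal OG$, that is, the kernel of the $\mathcal O$-algebra homomorphism $\mathcal OG\to\mathcal O$ sending every $x\in G$ to $1$. The following are equivalent. (i) The $\mathcal O$-algebra $A=\mathcal OG/\mathcal O\bigl(\sum_{x\in G}x\bigr)$ is symmetric, that is, $A$ is finitely generated projective as an $\mathcal O$-module and $A\cong\operatorname{Hom}_{\mathcal O}(A,\mathcal O)$ as $A$-$A$-bimodules. (ii) There exists an element $z\in Z(\mathcal OG)$ such that $I(\mathcal OG)=\mathcal OG\,z$. (iii) The group $G$ is $p$-nilpotent (it has a normal subgroup of order prime to $p$ and of $p$-power index) and has cyclic Sylow $p$-subgroups. -/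

import Mathlib

/-- A finite group is `p`-nilpotent if it has a normal subgroup of order prime to `p`
whose quotient is a `p`-group (a normal `p`-complement). -/
def IsPNilpotent (p : ℕ) (G : Type*) [Group G] : Prop :=
  ∃ N : Subgroup G, N.Normal ∧ (Nat.card N).Coprime p ∧ ∃ n : ℕ, N.index = p ^ n

/-- An `R`-algebra `A` is symmetric if it is finitely generated projective as an `R`-module and
isomorphic to its `R`-dual `Hom_R(A, R)` as an `A`-`A`-bimodule. The bimodule structure of the
dual is `(a • f • c) x = f (c * x * a)`. -/
structure IsSymmAlgebra (R A : Type*) [CommRing R] [Ring A] [Algebra R A] : Prop where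
  finite : Module.Finite R A
  projective : Module.Projective R A
  exists_equiv : ∃ Φ : A ≃ₗ[R] Module.Dual R A,
    ∀ a b c x : A, Φ (a * b * c) x = Φ b (c * x * a)

section GroupAlgebra

variable (R G : Type*) [CommRing R] [Group G]

/-- The augmentation map `R[G] → R`, sending every group element to `1`. -/
noncomputable def augmentationMap : MonoidAlgebra R G →ₐ[R] R :=
  MonoidAlgebra.lift R R G 1

/-- The augmentation ideal of `R[G]`, the kernel of the augmentation map. -/
noncomputable def augmentationIdeal : Ideal (MonoidAlgebra R G) :=
  RingHom.ker (augmentationMap R G)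

variable [Fintype G]

/-- The element `∑_{x ∈ G} x` of the group algebra. -/
noncomputable def groupSum : MonoidAlgebra R G :=
  ∑ x : G, MonoidAlgebra.of R G x

theorem mul_groupSum (a : MonoidAlgebra R G) :
    a * groupSum R G = augmentationMap R G a • groupSum R G := by
  induction a using MonoidAlgebra.induction_on with
  | of g =>
    have h : augmentationMap R G (MonoidAlgebra.of R G g) = 1 := by
      simp [augmentationMap]
    rw [h, one_smul, groupSum, Finset.mul_sum]
    simp_rw [← map_mul]
    exact Fintype.sum_equiv (Equiv.mulLeft g) _ _ (fun _ => rfl)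
  | add a b ha hb => rw [add_mul, ha, hb, map_add, add_smul]
  | smul r a ha => rw [smul_mul_assoc, ha, map_smul, smul_assoc]

theorem groupSum_mul (a : MonoidAlgebra R G) :
    groupSum R G * a = augmentationMap R G a • groupSum R G := by
  induction a using MonoidAlgebra.induction_on with
  | of g =>
    have h : augmentationMap R G (MonoidAlgebra.of R G g) = 1 := by
      simp [augmentationMap]
    rw [h, one_smul, groupSum, Finset.sum_mul]
    simp_rw [← map_mul]
    exact Fintype.sum_equiv (Equiv.mulRight g) _ _ (fun _ => rfl)
  | add a b ha hb => rw [mul_add, ha, hb, map_add, add_smul]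
  | smul r a ha => rw [mul_smul_comm, ha, map_smul, smul_assoc]

/-- The `R`-submodule `R (∑_{x ∈ G} x)` of the group algebra, as an ideal. -/
noncomputable def groupSumIdeal : Ideal (MonoidAlgebra R G) where
  toAddSubmonoid := (Submodule.span R {groupSum R G}).toAddSubmonoid
  smul_mem' a y hy := by
    obtain ⟨r, rfl⟩ := Submodule.mem_span_singleton.1 hy
    refine Submodule.mem_span_singleton.2 ⟨r * augmentationMap R G a, ?_⟩
    rw [smul_eq_mul, mul_smul_comm, mul_groupSum, mul_smul]

instance groupSumIdeal_isTwoSided : (groupSumIdeal R G).IsTwoSided where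
  mul_mem_of_left {y} a hy := by
    obtain ⟨r, rfl⟩ := Submodule.mem_span_singleton.1 hy
    refine Submodule.mem_span_singleton.2 ⟨r * augmentationMap R G a, ?_⟩
    rw [smul_mul_assoc, groupSum_mul, mul_smul]

end GroupAlgebra

/-! ### Generators of the augmentation ideal -/

section Augmentation

variable {R G : Type*} [CommRing R] [Group G]

open MonoidAlgebra

/-! The form `coeffOne` makes the group algebra symmetric, so each linear form is represented by an
element, and the forms killing the group sum are represented exactly by the augmentation ideal $I$
(`augmentationMap_dualElement`). Thus the dual of $A$ is $I$ as a bimodule; an isomorphism from $A$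
is determined by the image of $1$, a central generator of $I$. This gives (i) ⇔ (ii) over any
commutative ring.

For (iii) ⇒ (ii), the $p$-complement $N$ has invertible order, with averaging idempotent $e$. If $y$
generates $G/N$, then $(1-e)+(y-1)e$ is a central generator.

For (ii) ⇒ (iii), pass to the residue field $k$. A Fitting argument gives $z^n\in kGz^{2n}$ for some
$n>0$; the complement is the set $N$ of $g$ with $g-1\in kGz^n$. Modulo $z^n$ every element is a
polynomial in $z$, so $G/N$ is abelian, and Frobenius makes it a $p$-group. A Nakayama argument in
the local ring $k[G/N]$ then makes it cyclic, and Sylow $p$-subgroups embed in it. -/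

@[simp]
theorem augmentationMap_of (g : G) : augmentationMap R G (of R G g) = 1 := by
  simp [augmentationMap]

theorem mem_augmentationIdeal {y : MonoidAlgebra R G} :
    y ∈ augmentationIdeal R G ↔ augmentationMap R G y = 0 :=
  Iff.rfl

/-- Two `R`-linear maps on the group algebra agree if they agree on group elements. -/
theorem linearMap_ext_of {M : Type*} [AddCommGroup M] [Module R M]
    {f f' : MonoidAlgebra R G →ₗ[R] M} (h : ∀ g, f (of R G g) = f' (of R G g))
    (y : MonoidAlgebra R G) : f y = f' y := by
  induction y using MonoidAlgebra.induction_on with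
  | of g => exact h g
  | add a b ha hb => rw [map_add, map_add, ha, hb]
  | smul r a ha => rw [map_smul, map_smul, ha]

theorem commute_of_forall_of {z : MonoidAlgebra R G} (h : ∀ g, of R G g * z = z * of R G g)
    (y : MonoidAlgebra R G) : y * z = z * y :=
  linearMap_ext_of (f := LinearMap.mulRight R z) (f' := LinearMap.mulLeft R z) h y

/-- If every `g - 1` is a left multiple of `z`, so is every `y - ε(y)`. -/
theorem exists_sub_algebraMap_eq_mul {z : MonoidAlgebra R G}
    (h : ∀ g, ∃ a, of R G g - 1 = a * z) (y : MonoidAlgebra R G) :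
    ∃ a, y - algebraMap R _ (augmentationMap R G y) = a * z := by
  induction y using MonoidAlgebra.induction_on with
  | of g => rw [augmentationMap_of, map_one]; exact h g
  | add a b ha hb =>
    obtain ⟨c, hc⟩ := ha
    obtain ⟨d, hd⟩ := hb
    exact ⟨c + d, by rw [map_add, map_add, add_mul, ← hc, ← hd]; abel⟩
  | smul r a ha =>
    obtain ⟨c, hc⟩ := ha
    refine ⟨r • c, ?_⟩
    rw [smul_mul_assoc, ← hc, map_smul, smul_sub, Algebra.algebraMap_eq_smul_one,
      Algebra.algebraMap_eq_smul_one, smul_assoc]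

theorem augmentationIdeal_eq_span_iff {z : MonoidAlgebra R G} :
    augmentationIdeal R G = Ideal.span {z} ↔
      augmentationMap R G z = 0 ∧ ∀ g, ∃ a, of R G g - 1 = a * z := by
  constructor
  · intro h
    refine ⟨mem_augmentationIdeal.1 (h ▸ Ideal.mem_span_singleton_self z), fun g => ?_⟩
    have : of R G g - 1 ∈ augmentationIdeal R G := by
      rw [mem_augmentationIdeal, map_sub, augmentationMap_of, map_one, sub_self]
    obtain ⟨a, ha⟩ := Ideal.mem_span_singleton'.1 (h ▸ this)
    exact ⟨a, ha.symm⟩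
  · rintro ⟨h0, h⟩
    apply le_antisymm
    · intro y hy
      obtain ⟨a, ha⟩ := exists_sub_algebraMap_eq_mul h y
      rw [mem_augmentationIdeal.1 hy, map_zero, sub_zero] at ha
      exact Ideal.mem_span_singleton'.2 ⟨a, ha.symm⟩
    · rw [Ideal.span_le, Set.singleton_subset_iff]
      exact h0

end Augmentation

/-! ### The symmetrising form and representation of linear forms -/

section TraceForm

variable (R G : Type*) [CommRing R] [Group G]

open MonoidAlgebra

/-- The canonical symmetrising form of the group algebra: the coefficient at `1`. -/
noncomputable def coeffOne : MonoidAlgebra R G →ₗ[R] R where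
  toFun y := y.coeff 1
  map_add' _ _ := rfl
  map_smul' _ _ := rfl

variable {R G}

theorem coeffOne_mul_of (y : MonoidAlgebra R G) (g : G) :
    coeffOne R G (y * of R G g) = y.coeff g⁻¹ := by
  change (y * single g 1).coeff 1 = _
  rw [coeff_mul_single_apply]
  simp

theorem coeffOne_of_mul (y : MonoidAlgebra R G) (g : G) :
    coeffOne R G (of R G g * y) = y.coeff g⁻¹ := by
  change (single g 1 * y).coeff 1 = _
  rw [coeff_single_mul_apply]
  simp

theorem coeffOne_mul_comm (x y : MonoidAlgebra R G) :
    coeffOne R G (x * y) = coeffOne R G (y * x) :=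
  linearMap_ext_of (f := coeffOne R G ∘ₗ LinearMap.mulLeft R x)
    (f' := coeffOne R G ∘ₗ LinearMap.mulRight R x)
    (fun g => (coeffOne_mul_of x g).trans (coeffOne_of_mul x g).symm) y

/-- Nondegeneracy of the trace form: testing on $g^{-1}$ reads off the coefficient at $g$. -/
theorem eq_of_coeffOne_mul_eq {a b : MonoidAlgebra R G}
    (h : ∀ x, coeffOne R G (a * x) = coeffOne R G (b * x)) : a = b := by
  ext g
  simpa [coeffOne_mul_of, -of_apply] using h (of R G g⁻¹)

variable [Fintype G]

/-- The element of the group algebra representing a linear form with respect to `coeffOne`. -/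
noncomputable def dualElement (f : MonoidAlgebra R G →ₗ[R] R) : MonoidAlgebra R G :=
  ∑ g : G, f (of R G g⁻¹) • of R G g

theorem coeff_dualElement (f : MonoidAlgebra R G →ₗ[R] R) (g : G) :
    (dualElement f).coeff g = f (of R G g⁻¹) := by
  classical
  simp only [dualElement, coeff_sum, Finsupp.finsetSum_apply, coeff_smul_apply, of_apply,
    coeff_single, Finsupp.single_apply]
  simp

theorem coeffOne_dualElement_mul (f : MonoidAlgebra R G →ₗ[R] R) (x : MonoidAlgebra R G) :
    coeffOne R G (dualElement f * x) = f x :=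
  linearMap_ext_of (f := coeffOne R G ∘ₗ LinearMap.mulLeft R (dualElement f)) (f' := f)
    (fun g => by
      change coeffOne R G (dualElement f * of R G g) = _
      rw [coeffOne_mul_of, coeff_dualElement, inv_inv]) x

theorem coeffOne_groupSum : coeffOne R G (groupSum R G) = 1 := by
  classical
  change (groupSum R G).coeff 1 = 1
  simp [groupSum, coeff_sum, Finsupp.finsetSum_apply, Finsupp.single_apply]

theorem augmentationMap_dualElement (f : MonoidAlgebra R G →ₗ[R] R) :
    augmentationMap R G (dualElement f) = f (groupSum R G) := by
  rw [← coeffOne_dualElement_mul f (groupSum R G), mul_groupSum, map_smul, coeffOne_groupSum,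
    smul_eq_mul, mul_one]

end TraceForm

/-! ### Symmetry of the quotient and central generators -/

section Symmetric

variable {R G : Type*} [CommRing R] [Group G] [Fintype G]

open MonoidAlgebra

theorem mem_groupSumIdeal {y : MonoidAlgebra R G} :
    y ∈ groupSumIdeal R G ↔ ∃ r : R, r • groupSum R G = y :=
  Submodule.mem_span_singleton

theorem mk_groupSum : Ideal.Quotient.mk (groupSumIdeal R G) (groupSum R G) = 0 :=
  Ideal.Quotient.eq_zero_iff_mem.2 (mem_groupSumIdeal.2 ⟨1, one_smul _ _⟩)

/-- A linear map on the group algebra killing `groupSum` descends to the quotient. -/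
noncomputable def groupSumLift {M : Type*} [AddCommGroup M] [Module R M]
    (f : MonoidAlgebra R G →ₗ[R] M) (hf : f (groupSum R G) = 0) :
    (MonoidAlgebra R G ⧸ groupSumIdeal R G) →ₗ[R] M where
  __ := QuotientAddGroup.lift (groupSumIdeal R G).toAddSubgroup f.toAddMonoidHom (by
    intro y hy
    obtain ⟨r, rfl⟩ := mem_groupSumIdeal.1 hy
    simp [hf])
  map_smul' r y := by
    obtain ⟨y, rfl⟩ := Ideal.Quotient.mk_surjective y
    exact f.map_smul r y

/-- The group sum has coefficient $1$ at the identity, so subtracting $y_1\sum_x x$ from $y$ splits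
the quotient map. -/
theorem projective_quotient_groupSumIdeal :
    Module.Projective R (MonoidAlgebra R G ⧸ groupSumIdeal R G) := by
  have : Module.Free R (MonoidAlgebra R G) := inferInstance
  refine Module.Projective.of_split
    (groupSumLift (LinearMap.id - (coeffOne R G).smulRight (groupSum R G)) ?_)
    (Ideal.Quotient.mkₐ R (groupSumIdeal R G)).toLinearMap ?_
  · simp [coeffOne_groupSum]
  · refine LinearMap.ext fun y => ?_
    obtain ⟨y, rfl⟩ := Ideal.Quotient.mk_surjective y
    change Ideal.Quotient.mkₐ R (groupSumIdeal R G)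
      (y - coeffOne R G y • groupSum R G) = Ideal.Quotient.mk _ y
    rw [map_sub, map_smul, Ideal.Quotient.mkₐ_eq_mk, mk_groupSum, smul_zero, sub_zero]

theorem exists_center_of_isSymmAlgebra
    (h : IsSymmAlgebra R (MonoidAlgebra R G ⧸ groupSumIdeal R G)) :
    ∃ z ∈ Subalgebra.center R (MonoidAlgebra R G), augmentationIdeal R G = Ideal.span {z} := by
  obtain ⟨Φ, hΦ⟩ := h.exists_equiv
  set π := Ideal.Quotient.mkₐ R (groupSumIdeal R G)
  have hπ : π (groupSum R G) = 0 := mk_groupSum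
  have left (a x) : Φ a x = Φ 1 (x * a) := by simpa using hΦ a 1 1 x
  have right (a x) : Φ a x = Φ 1 (a * x) := by simpa using hΦ 1 1 a x
  set τ : MonoidAlgebra R G →ₗ[R] R := Φ 1 ∘ₗ π.toLinearMap
  have τ_comm (x y) : τ (x * y) = τ (y * x) := by
    change Φ 1 (π (x * y)) = Φ 1 (π (y * x))
    rw [map_mul π, map_mul π, ← right, left]
  -- The symmetry of `τ` becomes centrality of its representing element.
  have comm : ∀ y, y * dualElement τ = dualElement τ * y := by
    intro y
    refine eq_of_coeffOne_mul_eq fun x => ?_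
    rw [mul_assoc y, coeffOne_mul_comm y, mul_assoc, mul_assoc, coeffOne_dualElement_mul,
      coeffOne_dualElement_mul, τ_comm]
  have hε : augmentationMap R G (dualElement τ) = 0 := by
    rw [augmentationMap_dualElement]
    change Φ 1 (π _) = 0
    rw [hπ, map_zero]
  refine ⟨dualElement τ, Subalgebra.mem_center_iff.2 comm,
    augmentationIdeal_eq_span_iff.2 ⟨hε, fun g => ?_⟩⟩
  -- The form represented by $g-1$ descends to the quotient; its preimage under `Φ` is the required
  -- cofactor.
  obtain ⟨a, ha⟩ := Φ.surjective (groupSumLift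
    (coeffOne R G ∘ₗ LinearMap.mulLeft R (of R G g - 1)) (by
      change coeffOne R G ((of R G g - 1) * groupSum R G) = 0
      rw [mul_groupSum, map_sub, augmentationMap_of, map_one, sub_self, zero_smul, map_zero]))
  obtain ⟨a, rfl⟩ := Ideal.Quotient.mk_surjective a
  refine ⟨a, eq_of_coeffOne_mul_eq fun x => ?_⟩
  rw [comm, mul_assoc, coeffOne_dualElement_mul]
  have h1 := LinearMap.congr_fun ha (π x)
  rw [right] at h1
  exact h1.symm

/-- Invariance under left translation forces all coefficients to be equal. -/
theorem mem_groupSumIdeal_of_forall_of_mul {a : MonoidAlgebra R G}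
    (h : ∀ g, of R G g * a = a) : a ∈ groupSumIdeal R G := by
  refine mem_groupSumIdeal.2 ⟨a.coeff 1, ?_⟩
  refine eq_of_coeffOne_mul_eq fun x => ?_
  rw [coeffOne_mul_comm, coeffOne_mul_comm a]
  refine linearMap_ext_of (f := coeffOne R G ∘ₗ LinearMap.mulRight R (a.coeff 1 • groupSum R G))
    (f' := coeffOne R G ∘ₗ LinearMap.mulRight R a) (fun g => ?_) x
  change coeffOne R G (of R G g * (a.coeff 1 • groupSum R G)) = coeffOne R G (of R G g * a)
  rw [h, mul_smul_comm, mul_groupSum, augmentationMap_of, one_smul, map_smul, coeffOne_groupSum,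
    smul_eq_mul, mul_one]
  rfl

theorem isSymmAlgebra_of_exists_center {z : MonoidAlgebra R G}
    (hz : z ∈ Subalgebra.center R (MonoidAlgebra R G))
    (hI : augmentationIdeal R G = Ideal.span {z}) :
    IsSymmAlgebra R (MonoidAlgebra R G ⧸ groupSumIdeal R G) := by
  obtain ⟨hε, hgen⟩ := augmentationIdeal_eq_span_iff.1 hI
  have comm := Subalgebra.mem_center_iff.1 hz
  have hzσ : z * groupSum R G = 0 := by rw [mul_groupSum, hε, zero_smul]
  have key (a : MonoidAlgebra R G) :
      (coeffOne R G ∘ₗ LinearMap.mulLeft R (a * z)) (groupSum R G) = 0 := by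
    change coeffOne R G (a * z * groupSum R G) = 0
    rw [mul_assoc, hzσ, mul_zero, map_zero]
  let Φ₀ : MonoidAlgebra R G →ₗ[R] Module.Dual R (MonoidAlgebra R G ⧸ groupSumIdeal R G) :=
    { toFun a := groupSumLift _ (key a)
      map_add' a b := by
        refine LinearMap.ext fun x => ?_
        obtain ⟨x, rfl⟩ := Ideal.Quotient.mk_surjective x
        change coeffOne R G ((a + b) * z * x) =
          coeffOne R G (a * z * x) + coeffOne R G (b * z * x)
        rw [add_mul, add_mul, map_add]
      map_smul' r a := by
        refine LinearMap.ext fun x => ?_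
        obtain ⟨x, rfl⟩ := Ideal.Quotient.mk_surjective x
        change coeffOne R G (r • a * z * x) = r • coeffOne R G (a * z * x)
        rw [smul_mul_assoc, smul_mul_assoc, map_smul] }
  have hΦ₀ (a x) : Φ₀ a (Ideal.Quotient.mk _ x) = coeffOne R G (a * z * x) := rfl
  let Φ := groupSumLift Φ₀ (by
    refine LinearMap.ext fun x => ?_
    obtain ⟨x, rfl⟩ := Ideal.Quotient.mk_surjective x
    rw [hΦ₀, comm, hzσ, zero_mul, map_zero, LinearMap.zero_apply])
  have hΦ (a x) : Φ (Ideal.Quotient.mk _ a) (Ideal.Quotient.mk _ x) =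
    coeffOne R G (a * z * x) := rfl
  have inj : Function.Injective Φ := by
    rw [injective_iff_map_eq_zero]
    intro a ha
    obtain ⟨a, rfl⟩ := Ideal.Quotient.mk_surjective a
    have haz : a * z = 0 := eq_of_coeffOne_mul_eq fun x => by
      rw [← hΦ, ha, zero_mul, map_zero, LinearMap.zero_apply]
    -- Each $g-1$ is a multiple of the central `z`, so anything annihilating `z` is fixed by $G$.
    refine Ideal.Quotient.eq_zero_iff_mem.2 (mem_groupSumIdeal_of_forall_of_mul fun g => ?_)
    obtain ⟨b, hb⟩ := hgen g
    rw [← sub_eq_zero, ← sub_one_mul, hb, mul_assoc, ← comm, haz, mul_zero]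
  have surj : Function.Surjective Φ := by
    intro f
    let f' := f ∘ₗ (Ideal.Quotient.mkₐ R (groupSumIdeal R G)).toLinearMap
    have hw : dualElement f' ∈ augmentationIdeal R G := by
      rw [mem_augmentationIdeal, augmentationMap_dualElement]
      change f (Ideal.Quotient.mk _ _) = 0
      rw [mk_groupSum, map_zero]
    rw [hI] at hw
    obtain ⟨a, ha⟩ := Ideal.mem_span_singleton'.1 hw
    refine ⟨Ideal.Quotient.mk _ a, ?_⟩
    refine LinearMap.ext fun x => ?_
    obtain ⟨x, rfl⟩ := Ideal.Quotient.mk_surjective x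
    rw [hΦ, ha, coeffOne_dualElement_mul]
    rfl
  refine ⟨?_, projective_quotient_groupSumIdeal, LinearEquiv.ofBijective Φ ⟨inj, surj⟩, ?_⟩
  · have : Module.Finite R (MonoidAlgebra R G) := inferInstance
    exact Module.Finite.of_surjective (Ideal.Quotient.mkₐ R (groupSumIdeal R G)).toLinearMap
      Ideal.Quotient.mk_surjective
  · intro a b c x
    obtain ⟨a, rfl⟩ := Ideal.Quotient.mk_surjective a
    obtain ⟨b, rfl⟩ := Ideal.Quotient.mk_surjective b
    obtain ⟨c, rfl⟩ := Ideal.Quotient.mk_surjective c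
    obtain ⟨x, rfl⟩ := Ideal.Quotient.mk_surjective x
    change coeffOne R G (a * b * c * z * x) = coeffOne R G (b * z * (c * x * a))
    rw [← mul_assoc, coeffOne_mul_comm _ a]
    simp only [mul_assoc]
    rw [← mul_assoc c z, comm c, mul_assoc]

end Symmetric

/-! ### From a normal p-complement to a central generator -/

section Averaging

variable {R G : Type*} [CommRing R] [Group G] [Finite G]

open MonoidAlgebra

/-- A finite group with a normal subgroup of invertible order and cyclic quotient has augmentation
ideal generated by a central element. -/
theorem exists_center_augmentationIdeal_eq_span (N : Subgroup G) [N.Normal] [IsCyclic (G ⧸ N)]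
    (hN : IsUnit (Nat.card N : R)) :
    ∃ z ∈ Subalgebra.center R (MonoidAlgebra R G), augmentationIdeal R G = Ideal.span {z} := by
  classical
  have := Fintype.ofFinite N
  obtain ⟨u, hu⟩ := hN.exists_left_inv
  let e : MonoidAlgebra R G := u • ∑ n : N, of R G n
  have he_left (m : N) : of R G m * e = e := by
    simp only [e, mul_smul_comm, Finset.mul_sum, ← map_mul]
    congr 1
    exact Fintype.sum_equiv (Equiv.mulLeft m) _ _ fun _ => rfl
  have he_comm (y) : y * e = e * y := by
    refine commute_of_forall_of (fun g => ?_) y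
    simp only [e, mul_smul_comm, smul_mul_assoc, Finset.mul_sum, Finset.sum_mul, ← map_mul]
    congr 1
    refine Fintype.sum_equiv (MulAut.conjNormal g).toEquiv _ _ fun n => ?_
    congr 1
    simp
  have hεe : augmentationMap R G e = 1 := by
    simp only [e, map_smul, map_sum, augmentationMap_of]
    simpa [Nat.card_eq_fintype_card] using hu
  have hee : e * e = e := by
    have h1 : (∑ n : N, of R G n) * e = (Nat.card N : R) • e := by
      simp only [Finset.sum_mul, he_left]
      simp [Nat.card_eq_fintype_card, Nat.cast_smul_eq_nsmul]
    change u • (∑ n : N, of R G n) * e = e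
    rw [smul_mul_assoc, h1, smul_smul, hu, one_smul]
  obtain ⟨q, hq⟩ := IsCyclic.exists_monoid_generator (α := G ⧸ N)
  obtain ⟨y, rfl⟩ := QuotientGroup.mk_surjective q
  have he_coset {g h : G} (hgh : (g : G ⧸ N) = h) : of R G g * e = of R G h * e := by
    have hm : g⁻¹ * h ∈ N := QuotientGroup.eq.1 hgh
    have : h = g * (g⁻¹ * h) := by group
    rw [this, map_mul, mul_assoc, he_left ⟨_, hm⟩]
  -- Multiplication by `e` only sees cosets of `N`, and the cyclic quotient is abelian.
  have hye (x) : x * ((of R G y - 1) * e) = (of R G y - 1) * e * x := by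
    refine commute_of_forall_of (fun g => ?_) x
    have hgy : (↑(g * y) : G ⧸ N) = ↑(y * g) := by
      obtain ⟨i, hi⟩ := Submonoid.mem_powers_iff _ _ |>.1 (hq g)
      rw [QuotientGroup.mk_mul, QuotientGroup.mk_mul, ← hi]
      exact (Commute.pow_self _ _)
    rw [mul_assoc, ← he_comm, ← mul_assoc, ← mul_assoc, mul_sub, sub_mul _ _ (of R G g), ← map_mul,
      ← map_mul, mul_one, one_mul, sub_mul, sub_mul, he_coset hgy]
  -- The block of $1-e$ lies in the augmentation ideal, so its identity serves there; on the block
  -- of $e$, a copy of $R[G/N]$, the generator is $y-1$.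
  refine ⟨(1 - e) + (of R G y - 1) * e, Subalgebra.mem_center_iff.2 fun x => ?_,
    augmentationIdeal_eq_span_iff.2 ⟨?_, fun g => ?_⟩⟩
  · rw [mul_add, add_mul, hye, mul_sub, sub_mul 1 e x, mul_one, one_mul, he_comm]
  · simp only [map_add, map_sub, map_mul, hεe, map_one, augmentationMap_of]
    simp
  · obtain ⟨i, hi⟩ := Submonoid.mem_powers_iff _ _ |>.1 (hq g)
    have hge : of R G g * e = of R G y ^ i * e := by
      rw [← map_pow]
      exact he_coset (by rw [QuotientGroup.mk_pow, hi])
    have h1 : (1 - e) * ((1 - e) + (of R G y - 1) * e) = 1 - e := by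
      have : (1 - e) * e = 0 := by rw [sub_mul, one_mul, hee, sub_self]
      rw [mul_add, he_comm (of R G y - 1), ← mul_assoc, this, zero_mul, add_zero, mul_sub, this, mul_one,
        sub_zero]
    have h2 : e * ((1 - e) + (of R G y - 1) * e) = (of R G y - 1) * e := by
      rw [mul_add, mul_sub, mul_one, hee, sub_self, zero_add, ← he_comm, mul_assoc, hee]
    -- On the block of `e`, $g$ acts as $y^i$, and $y^i-1$ is a geometric sum times $y-1$.
    refine ⟨(of R G g - 1) * (1 - e) + (∑ j ∈ Finset.range i, of R G y ^ j) * e, ?_⟩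
    rw [add_mul, mul_assoc, h1, mul_assoc, h2, ← mul_assoc, geom_sum_mul, sub_mul _ _ e, ← hge,
      ← sub_mul, ← mul_add, sub_add_cancel, mul_one]

theorem injective_mk_comp_subtype_sylow {p : ℕ} [Fact p.Prime] {N : Subgroup G} [N.Normal]
    (hN : (Nat.card N).Coprime p) (P : Sylow p G) :
    Function.Injective ((QuotientGroup.mk' N).comp (P : Subgroup G).subtype) := by
  obtain ⟨m, hm⟩ := IsPGroup.iff_card.1 P.isPGroup'
  have hPN : (P : Subgroup G) ⊓ N = ⊥ := (Subgroup.disjoint_of_coprime_natCard (by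
    rw [hm]; exact (hN.pow_right m).symm)).eq_bot
  rw [injective_iff_map_eq_one]
  intro x hx
  have : (x : G) ∈ (P : Subgroup G) ⊓ N := ⟨x.2, (QuotientGroup.eq_one_iff _).1 hx⟩
  rw [hPN, Subgroup.mem_bot] at this
  exact Subtype.ext this

/-- The index of `N` is a power of $p$ dividing $|G|$, hence divides $|P|$; the injection $P\to G/N$
is therefore onto. -/
theorem isCyclic_quotient_of_isCyclic_sylow {p : ℕ} [Fact p.Prime] {N : Subgroup G} [N.Normal]
    (hN : (Nat.card N).Coprime p) {n : ℕ} (hn : N.index = p ^ n) (P : Sylow p G) [IsCyclic P] :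
    IsCyclic (G ⧸ N) := by
  have hf := injective_mk_comp_subtype_sylow hN P
  have hdvd : Nat.card (G ⧸ N) ∣ Nat.card P := by
    change N.index ∣ _
    rw [hn]
    refine P.pow_dvd_card_of_pow_dvd_card ?_
    rw [← hn]
    exact N.index_dvd_card
  have hcard := Nat.le_of_dvd Nat.card_pos hdvd
  have hb : Function.Bijective ((QuotientGroup.mk' N).comp (P : Subgroup G).subtype) := by
    have := Fintype.ofFinite P
    have := Fintype.ofFinite (G ⧸ N)
    refine (Fintype.bijective_iff_injective_and_card _).2 ⟨hf, ?_⟩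
    rw [← Nat.card_eq_fintype_card, ← Nat.card_eq_fintype_card]
    exact le_antisymm (Nat.card_le_card_of_injective _ hf) hcard
  exact isCyclic_of_surjective _ hb.2

end Averaging

/-! ### Change of coefficients and of group -/

section BaseChange

open MonoidAlgebra

variable {R S G H : Type*} [CommRing R] [CommRing S] [Group G] [Group H]

/-- A central generator of the augmentation ideal is mapped to a central generator under
surjections in both the coefficients and the group. -/
theorem exists_center_generator_map (φ : R →+* S) (f : G →* H) (hf : Function.Surjective f)
    (h : ∃ z ∈ Subalgebra.center R (MonoidAlgebra R G), augmentationIdeal R G = Ideal.span {z}) :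
    ∃ z ∈ Subalgebra.center S (MonoidAlgebra S H), augmentationIdeal S H = Ideal.span {z} := by
  obtain ⟨z, hz, hI⟩ := h
  obtain ⟨hε, hgen⟩ := augmentationIdeal_eq_span_iff.1 hI
  have comm := Subalgebra.mem_center_iff.1 hz
  let π : MonoidAlgebra R G →+* MonoidAlgebra S H :=
    (mapDomainRingHom S f).comp (mapRingHom G φ)
  have hπ (g : G) : π (of R G g) = of S H (f g) := by simp [π]
  have hπε (y) : augmentationMap S H (π y) = φ (augmentationMap R G y) := by
    induction y using MonoidAlgebra.induction_on with
    | of g => rw [hπ, augmentationMap_of, augmentationMap_of, map_one]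
    | add a b ha hb => simp only [map_add, ha, hb]
    | smul r a ha =>
      have hr : π (algebraMap R _ r) = algebraMap S _ (φ r) := by simp [π]
      rw [Algebra.smul_def, map_mul, map_mul, map_mul, map_mul, ha, hr, AlgHom.commutes,
        AlgHom.commutes]
      rfl
  refine ⟨π z, Subalgebra.mem_center_iff.2 (commute_of_forall_of fun h => ?_),
    augmentationIdeal_eq_span_iff.2 ⟨by rw [hπε, hε, map_zero], fun h => ?_⟩⟩
  · obtain ⟨g, rfl⟩ := hf h
    rw [← hπ, ← map_mul, ← map_mul, comm]
  · obtain ⟨g, rfl⟩ := hf h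
    obtain ⟨a, ha⟩ := hgen g
    exact ⟨π a, by rw [← hπ, ← map_mul, ← ha, map_sub, map_one]⟩

end BaseChange

/-! ### Abelian p-groups with principal augmentation ideal -/

section CyclicOfPrincipal

open MonoidAlgebra

variable {k : Type*} [Field k] {p : ℕ} [CharP k p]

theorem charP_monoidAlgebra (G : Type*) [Monoid G] : CharP (MonoidAlgebra k G) p :=
  charP_of_injective_algebraMap' k p

theorem subsingleton_of_of_sub_one_eq_zero {G : Type*} [Group G]
    (h : ∀ g, of k G g - 1 = 0) : Subsingleton G := by
  refine ⟨fun a b => of_injective (R := k) ?_⟩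
  rw [sub_eq_zero.1 (h a), sub_eq_zero.1 (h b)]

/-- The algebra is local with nilpotent $g-1$, so by Nakayama some $x-1$ already generates $I$
unless $I=0$. -/
theorem isCyclic_of_augmentationIdeal_eq_span {Q : Type*} [CommGroup Q] [Fact p.Prime] (hQ : IsPGroup p Q)
    {z : MonoidAlgebra k Q} (hI : augmentationIdeal k Q = Ideal.span {z}) : IsCyclic Q := by
  obtain ⟨hε, hgen⟩ := augmentationIdeal_eq_span_iff.1 hI
  have := charP_monoidAlgebra (k := k) (p := p) Q
  have hnil : ∀ g, IsNilpotent (of k Q g - 1) := fun g => by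
    obtain ⟨m, hm⟩ := hQ g
    exact ⟨p ^ m, by rw [sub_pow_char_pow, ← map_pow, hm, map_one, one_pow, sub_self]⟩
  have hunit : ∀ a, augmentationMap k Q a ≠ 0 → IsUnit a := by
    intro a ha
    have hn : IsNilpotent (a - algebraMap k _ (augmentationMap k Q a)) := by
      generalize ha' : a = b
      clear ha ha' a
      induction b using MonoidAlgebra.induction_on with
      | of g => simpa only [augmentationMap_of, map_one] using hnil g
      | add a b ha hb =>
        rw [map_add, map_add, add_sub_add_comm]
        exact (Commute.all _ _).isNilpotent_add ha hb
      | smul r a ha =>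
        rw [map_smul, smul_eq_mul, map_mul, Algebra.smul_def, ← mul_sub]
        exact (Commute.all _ _).isNilpotent_mul_left ha
    have := hn.isUnit_add_left_of_commute
      ((isUnit_iff_ne_zero.2 ha).map (algebraMap k (MonoidAlgebra k Q))) (Commute.all _ _)
    simpa using this
  -- If such `x` exists, `z` is a multiple of $x-1$ and dies in the algebra of $Q/\langle x\rangle$,
  -- making that quotient trivial.
  by_cases hx : ∃ x a, of k Q x - 1 = a * z ∧ augmentationMap k Q a ≠ 0
  · obtain ⟨x, a, hxa, ha⟩ := hx
    obtain ⟨b, hb⟩ := (hunit a ha).exists_left_inv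
    let H := Subgroup.zpowers x
    let π := mapDomainRingHom k (QuotientGroup.mk' H)
    have hπ (g : Q) : π (of k Q g) = of k (Q ⧸ H) g := by simp [π]
    have hπz : π z = 0 := by
      have : z = b * (of k Q x - 1) := by rw [hxa, ← mul_assoc, hb, one_mul]
      rw [this, map_mul, map_sub, hπ, map_one,
        (QuotientGroup.eq_one_iff x).2 (Subgroup.mem_zpowers x), map_one, sub_self, mul_zero]
    have : Subsingleton (Q ⧸ H) := subsingleton_of_of_sub_one_eq_zero (k := k) fun q => by
      obtain ⟨g, rfl⟩ := QuotientGroup.mk_surjective q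
      obtain ⟨c, hc⟩ := hgen g
      rw [← hπ, ← map_one π, ← map_sub, hc, map_mul, hπz, mul_zero]
    exact ⟨x, fun y => (QuotientGroup.eq_one_iff (N := H) y).1 (Subsingleton.elim _ _)⟩
  -- Now every cofactor lies in $I$, so $I\subseteq kQz^2$. Then $z=cz^2$ with $1-cz$ a unit, and
  -- $z=0$.
  · push Not at hx
    have hz : ∃ c, z = c * (z * z) := by
      obtain ⟨c, hc⟩ : ∃ c, z - algebraMap k _ (augmentationMap k Q z) = c * (z * z) :=
        exists_sub_algebraMap_eq_mul (fun g => by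
          obtain ⟨a, ha⟩ := hgen g
          obtain ⟨d, hd⟩ := exists_sub_algebraMap_eq_mul hgen a
          rw [hx g a ha, map_zero, sub_zero] at hd
          exact ⟨d, by rw [ha, hd, mul_assoc]⟩) z
      exact ⟨c, by rwa [hε, map_zero, sub_zero] at hc⟩
    obtain ⟨c, hc⟩ := hz
    have hu : IsUnit (1 - c * z) := hunit _ (by rw [map_sub, map_mul, hε]; simp)
    have hz0 : z = 0 := by
      refine (hu.mul_right_eq_zero).1 ?_
      rw [sub_mul, one_mul, mul_assoc, ← hc, sub_self]
    have : Subsingleton Q := subsingleton_of_of_sub_one_eq_zero (k := k) fun g => by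
      obtain ⟨a, ha⟩ := hgen g
      rw [ha, hz0, mul_zero]
    infer_instance

end CyclicOfPrincipal

/-! ### The normal p-complement cut out by a power of z -/

section PNilpotent

open MonoidAlgebra

/-- In an Artinian ring every element `z` satisfies `z ^ n = c * z ^ (2 * n)` for some `n ≥ 1`. -/
theorem exists_pow_eq_mul_pow_two_mul {A : Type*} [Ring A] [IsArtinianRing A] (z : A) :
    ∃ n, 0 < n ∧ ∃ c, z ^ n = c * (z ^ n * z ^ n) := by
  let f : ℕ →o (Ideal A)ᵒᵈ :=
    ⟨fun n => OrderDual.toDual (Ideal.span {z ^ n}), monotone_nat_of_le_succ fun n => by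
      change Ideal.span {z ^ (n + 1)} ≤ Ideal.span {z ^ n}
      rw [Ideal.span_le, Set.singleton_subset_iff, pow_succ']
      exact Ideal.mul_mem_left _ _ (Ideal.mem_span_singleton_self _)⟩
  obtain ⟨n, hn⟩ := IsArtinian.monotone_stabilizes f
  -- The stabilization index may be zero; the shift keeps the exponent positive.
  have h : Ideal.span {z ^ (n + 1)} = Ideal.span {z ^ ((n + 1) + (n + 1))} :=
    (hn (n + 1) (by omega)).symm.trans (hn ((n + 1) + (n + 1)) (by omega))
  obtain ⟨c, hc⟩ := Ideal.mem_span_singleton'.1 (h ▸ Ideal.mem_span_singleton_self (z ^ (n + 1)))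
  exact ⟨n + 1, n.succ_pos, c, by rw [← pow_add, hc]⟩

variable {k G : Type*} [Field k] [Group G]

/-- The elements `g` of `G` for which `g - 1` is a left multiple of `w`. -/
def dividingSubgroup (w : MonoidAlgebra k G) : Subgroup G where
  carrier := {g | ∃ a, of k G g - 1 = a * w}
  one_mem' := ⟨0, by rw [map_one, sub_self, zero_mul]⟩
  mul_mem' := by
    rintro g h ⟨a, ha⟩ ⟨b, hb⟩
    refine ⟨of k G g * b + a, ?_⟩
    rw [add_mul, mul_assoc, ← ha, ← hb, mul_sub, map_mul, mul_one, sub_add_sub_cancel]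
  inv_mem' := by
    rintro g ⟨a, ha⟩
    refine ⟨-of k G g⁻¹ * a, ?_⟩
    rw [mul_assoc, ← ha, neg_mul, mul_sub, ← map_mul, inv_mul_cancel, map_one, mul_one, neg_sub]

theorem dividingSubgroup_normal {w : MonoidAlgebra k G} (comm : ∀ y, y * w = w * y) :
    (dividingSubgroup w).Normal where
  conj_mem := by
    rintro g ⟨a, ha⟩ h
    refine ⟨of k G h * a * of k G h⁻¹, ?_⟩
    rw [mul_assoc (_ * a), comm (of k G h⁻¹), ← mul_assoc, mul_assoc _ a w, ← ha, mul_sub, sub_mul, mul_one, ← map_mul,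
      ← map_mul, ← map_mul, mul_inv_cancel, map_one]

/-- If left translation by the elements of `N` fixes an element of augmentation one, then the order
of `N` is nonzero in `k`. -/
theorem natCard_ne_zero_of_forall_of_mul_eq [Finite G] (N : Subgroup G) {f : MonoidAlgebra k G}
    (hf : augmentationMap k G f = 1) (h : ∀ n ∈ N, of k G n * f = f) :
    (Nat.card N : k) ≠ 0 := by
  intro h0
  have := Fintype.ofFinite G
  have := Fintype.ofFinite N
  have := Fintype.ofFinite (G ⧸ N)
  -- These coefficients are constant on the cosets $gN$, so the augmentation of `f` is a multiple of
  -- $|N|$.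
  have hcoeff (g : G) (n : N) : f.coeff (g * n)⁻¹ = f.coeff g⁻¹ := by
    rw [← coeffOne_mul_of, ← coeffOne_mul_of, map_mul (of k G), coeffOne_mul_comm, mul_assoc,
      h n n.2, coeffOne_mul_comm]
  have hsum : augmentationMap k G f = ∑ g : G, f.coeff g⁻¹ := by
    have h1 := congrArg (coeffOne k G) (mul_groupSum k G f)
    rw [map_smul, coeffOne_groupSum, smul_eq_mul, mul_one] at h1
    rw [← h1, groupSum, Finset.mul_sum, map_sum]
    exact Finset.sum_congr rfl fun g _ => coeffOne_mul_of f g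
  have h1 : ∑ g : G, f.coeff g⁻¹ = ∑ x : (G ⧸ N) × N, f.coeff (x.1.out)⁻¹ := by
    refine Fintype.sum_equiv Subgroup.groupEquivQuotientProdSubgroup _ _ fun g => ?_
    change f.coeff g⁻¹ = f.coeff (g : G ⧸ N).out⁻¹
    have hg : (g : G ⧸ N).out⁻¹ * g ∈ N := QuotientGroup.eq.1 (Quotient.out_eq' _)
    rw [← hcoeff (g : G ⧸ N).out ⟨_, hg⟩, mul_inv_cancel_left]
  rw [hf, h1, Fintype.sum_prod_type] at hsum
  simp [← Nat.card_eq_fintype_card, h0] at hsum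

theorem isPNilpotent_and_isCyclic_sylow {p : ℕ} [Fact p.Prime] [CharP k p] [Finite G]
    (hz : ∃ z ∈ Subalgebra.center k (MonoidAlgebra k G), augmentationIdeal k G = Ideal.span {z}) :
    IsPNilpotent p G ∧ ∀ P : Sylow p G, IsCyclic P := by
  have hz' := hz
  obtain ⟨z, hz, hI⟩ := hz
  obtain ⟨hε, hgen⟩ := augmentationIdeal_eq_span_iff.1 hI
  have comm := Subalgebra.mem_center_iff.1 hz
  have : IsArtinianRing (MonoidAlgebra k G) := IsArtinianRing.of_finite k _
  have := charP_monoidAlgebra (k := k) (p := p) G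
  obtain ⟨n, hn, c, hc⟩ := exists_pow_eq_mul_pow_two_mul z
  have commn (y) : y * z ^ n = z ^ n * y := (Commute.pow_right (comm y) n)
  let N := dividingSubgroup (z ^ n)
  have hNn : N.Normal := dividingSubgroup_normal commn
  -- A $z$-adic expansion: each cofactor is its augmentation plus a multiple of `z`.
  have hpow (m : ℕ) (y) : ∃ r a, y = Polynomial.aeval z (r : Polynomial k) + a * z ^ m := by
    induction m generalizing y with
    | zero => exact ⟨0, y, by simp⟩
    | succ m ih =>
      obtain ⟨r, a, ha⟩ := ih y
      obtain ⟨b, hb⟩ := exists_sub_algebraMap_eq_mul hgen a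
      refine ⟨r + Polynomial.C (augmentationMap k G a) * Polynomial.X ^ m, b, ?_⟩
      rw [pow_succ', ← mul_assoc, ← hb, sub_mul, map_add, map_mul, map_pow, Polynomial.aeval_C,
        Polynomial.aeval_X, add_assoc, add_sub_cancel, ← ha]
  have hNcard : (Nat.card N : k) ≠ 0 := by
    -- $z^n$ annihilates $1-cz^n$, hence so does $g-1$ for $g\in N$.
    refine natCard_ne_zero_of_forall_of_mul_eq N (f := 1 - c * z ^ n) ?_ fun g hg => ?_
    · rw [map_sub, map_mul, map_pow, hε, zero_pow hn.ne', map_one, mul_zero, sub_zero]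
    · obtain ⟨a, ha⟩ := hg
      rw [← sub_eq_zero, ← sub_one_mul, ha, mul_assoc, mul_sub, mul_one, ← mul_assoc, ← commn,
        mul_assoc, ← hc, sub_self, mul_zero]
  have hNp : (Nat.card N).Coprime p := by
    rw [Nat.coprime_comm, (Fact.out : p.Prime).coprime_iff_not_dvd, ← CharP.cast_eq_zero_iff k p]
    exact hNcard
  have hQp : IsPGroup p (G ⧸ N) := by
    intro q
    obtain ⟨g, rfl⟩ := QuotientGroup.mk_surjective q
    -- Since $p^n\ge n$, $g^{p^n}-1=(g-1)^{p^n}=a^{p^n}z^{p^n}$ is a multiple of $z^n$.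
    refine ⟨n, ?_⟩
    rw [← QuotientGroup.mk_pow, QuotientGroup.eq_one_iff]
    obtain ⟨a, ha⟩ := hgen g
    have hle : n ≤ p ^ n := (Nat.lt_pow_self (Fact.out : p.Prime).one_lt).le
    refine ⟨a ^ p ^ n * z ^ (p ^ n - n), ?_⟩
    rw [mul_assoc, ← pow_add, Nat.sub_add_cancel hle, ← Commute.mul_pow (comm a), ← ha,
      sub_pow_char_pow_of_commute _ _ (Commute.one_right _), one_pow, map_pow]
  have hQcomm (q q' : G ⧸ N) : q * q' = q' * q := by
    obtain ⟨g, rfl⟩ := QuotientGroup.mk_surjective q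
    obtain ⟨h, rfl⟩ := QuotientGroup.mk_surjective q'
    rw [← QuotientGroup.mk_mul, ← QuotientGroup.mk_mul, QuotientGroup.eq]
    obtain ⟨r, a, ha⟩ := hpow n (of k G g)
    obtain ⟨s, b, hb⟩ := hpow n (of k G h)
    have hrs : Commute (Polynomial.aeval z r) (Polynomial.aeval z s) := by
      change _ * _ = _ * _
      rw [← map_mul, mul_comm, map_mul]
    have key : ∃ d, of k G (h * g) - of k G (g * h) = d * z ^ n := by
      have swap (u v) : u * z ^ n * v = u * v * z ^ n := by rw [mul_assoc, ← commn, mul_assoc]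
      rw [map_mul, map_mul, ha, hb]
      generalize Polynomial.aeval z r = A at *
      generalize Polynomial.aeval z s = B at *
      refine ⟨B * a + b * A + b * z ^ n * a - (A * b + a * B + a * z ^ n * b), ?_⟩
      simp only [mul_add, add_mul, sub_mul, ← mul_assoc, swap b A, swap a B]
      rw [hrs.eq]
      abel
    obtain ⟨d, hd⟩ := key
    refine ⟨of k G (g * h)⁻¹ * d, ?_⟩
    rw [mul_assoc, ← hd, mul_sub, ← map_mul, ← map_mul, inv_mul_cancel, map_one]
  have hQcyc : IsCyclic (G ⧸ N) := by
    let _ : CommGroup (G ⧸ N) := { (inferInstance : Group (G ⧸ N)) with mul_comm := hQcomm }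
    obtain ⟨w, -, hw⟩ := exists_center_generator_map (RingHom.id k) (QuotientGroup.mk' N)
      (QuotientGroup.mk'_surjective N) hz'
    exact isCyclic_of_augmentationIdeal_eq_span hQp hw
  obtain ⟨m, hm⟩ := IsPGroup.iff_card.1 hQp
  refine ⟨⟨N, hNn, hNp, m, hm⟩, fun P => ?_⟩
  exact isCyclic_of_injective _ (injective_mk_comp_subtype_sylow hNp P)

end PNilpotent

theorem proposition1p9 (p : ℕ) (hp : p.Prime)
    (O : Type*) [CommRing O] [IsDomain O] [IsDiscreteValuationRing O]
    [IsAdicComplete (IsLocalRing.maximalIdeal O) O]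
    [CharZero (FractionRing O)] [CharP (IsLocalRing.ResidueField O) p]
    (G : Type*) [Group G] [Fintype G] :
    List.TFAE [
      IsSymmAlgebra O (MonoidAlgebra O G ⧸ groupSumIdeal O G),
      ∃ z ∈ Subalgebra.center O (MonoidAlgebra O G), augmentationIdeal O G = Ideal.span {z},
      IsPNilpotent p G ∧ ∀ P : Sylow p G, IsCyclic P] := by
  have : Fact p.Prime := ⟨hp⟩
  tfae_have 1 → 2 := exists_center_of_isSymmAlgebra
  tfae_have 2 → 1 := fun ⟨_, hz, hI⟩ => isSymmAlgebra_of_exists_center hz hI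
  tfae_have 2 → 3 := fun h => isPNilpotent_and_isCyclic_sylow
    (exists_center_generator_map (IsLocalRing.residue O) (MonoidHom.id G) Function.surjective_id h)
  tfae_have 3 → 2 := by
    rintro ⟨⟨N, hN, hcop, n, hn⟩, hP⟩
    have : IsCyclic (G ⧸ N) :=
      have := hP default
      isCyclic_quotient_of_isCyclic_sylow hcop hn (default : Sylow p G)
    refine exists_center_augmentationIdeal_eq_span N ?_
    -- In a local ring, an element with nonzero residue is a unit.
    refine isUnit_of_map_unit (IsLocalRing.residue O) _ (isUnit_iff_ne_zero.2 ?_)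
    rw [map_natCast, Ne, CharP.cast_eq_zero_iff _ p, ← hp.coprime_iff_not_dvd]
    exact hcop.symm
  tfae_finish
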